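/- Let $X,Z\in\mathbb{R}^{n\times r}$ satisfy $XX^T\neq ZZ^T$. For a linear map $\mathcal{A}:\mathbb{R}^{n\times n}\to\mathbb{R}^m$ let $f_{\mathcal{A}}(U)=\|\mathcal{A}(UU^T-ZZ^T)\|^2$ for $U\in\mathbb{R}^{n\times r}$. For $0\le\delta<1$ say that $\mathcal{A}$ satisfies $(\delta,p)$-RIP if there is $\nu>0$ such that $$(1-\delta)\|E\|_F^2\le\tfrac1\nu\|\mathcal{A}(E)\|^2\le(1+\delta)\|E\|_F^2\quad\text{for all }E\in\mathbb{R}^{n\times n}\text{ with }\operatorname{rank}(E)\le p.$$ Let $\delta(X,Z)$ be the RIP threshold function: the infimum, over all $m$ and all linear $\mathcal{A}:\mathbb{R}^{n\times n}\to\mathbb{R}^m$ with $\nabla f_{\mathcal{A}}(X)=0$ and $\nabla^2 f_{\mathcal{A}}(X)\succeq 0$, of the constants $\delta$ for which $\mathcal{A}$ satisfies $(\delta,\,r+\operatorname{rank}(Z))$-RIP, with $\delta(X,Z)=1$ if there is no such $\mathcal{A}$ and $\delta$. Put $Z_\perp=(I-XX^\dagger)Z$, where $X^\dagger$ is the Moore--Penrose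 pseudoinverse, and $$\alpha=\frac{\|Z_\perp Z_\perp^T\|_F}{\|XX^T-ZZ^T\|_F},\qquad \beta=\frac{\sigma_{\min}^2(X)}{\|XX^T-ZZ^T\|_F}\cdot\frac{\operatorname{tr}(Z_\perp Z_\perp^T)}{\|Z_\perp Z_\perp^T\|_F},$$ where $\sigma_{\min}(X)$ is the smallest of the $\min\{n,r\}$ singular values of $X$, and $\beta=0$ if $Z_\perp=0$ (in that case $\alpha=0$, and $\gamma(\alpha,\beta)$ below equals $1$ for every choice of $\beta\ge0$). Then $$\delta(X,Z)\ge\gamma(\alpha,\beta),\qquad \gamma(\alpha,\beta)=\begin{cases}\sqrt{1-\alpha^2} & \text{if }\beta\ge\dfrac{\alpha}{1+\sqrt{1-\alpha^2}},\\[2ex]\dfrac{1-2\alpha\beta+\beta^2}{1-\beta^2} & \text{if }\beta<\dfrac{\alpha}{1+\sqrt{1-\alpha^2}}.\end{cases}$$ -/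

import Mathlib

open scoped Matrix Matrix.Norms.Frobenius

namespace MatrixSensing

noncomputable section

/-- The Moore-Penrose pseudoinverse `V S⁻¹ Uᵀ` of a real matrix `X = U S Vᵀ`, computed from the
spectral decomposition `Xᵀ X = W diag(d) Wᵀ` as `W diag(d⁻¹) Wᵀ Xᵀ`, where `0⁻¹ = 0`. -/
def pinv {n r : ℕ} (X : Matrix (Fin n) (Fin r) ℝ) : Matrix (Fin r) (Fin n) ℝ :=
  let h : (Xᵀ * X).IsHermitian := Matrix.isHermitian_conjTranspose_mul_self X
  let W : Matrix (Fin r) (Fin r) ℝ := h.eigenvectorUnitary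
  W * Matrix.diagonal (fun i => (h.eigenvalues i)⁻¹) * Wᵀ * Xᵀ

/-- `pinv X` satisfies the four Penrose equations, which characterize the pseudoinverse. -/
theorem pinv_penrose {n r : ℕ} (X : Matrix (Fin n) (Fin r) ℝ) :
    X * pinv X * X = X ∧ pinv X * X * pinv X = pinv X ∧
      (X * pinv X)ᵀ = X * pinv X ∧ (pinv X * X)ᵀ = pinv X * X := by
  have h : (Xᵀ * X).IsHermitian := Matrix.isHermitian_conjTranspose_mul_self X
  obtain ⟨W, hW⟩ : ∃ W : Matrix (Fin r) (Fin r) ℝ, W = h.eigenvectorUnitary := ⟨_, rfl⟩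
  obtain ⟨d, hd⟩ : ∃ d : Fin r → ℝ, d = h.eigenvalues := ⟨_, rfl⟩
  have hWW : Wᵀ * W = 1 := by
    rw [hW]; exact Unitary.coe_star_mul_self h.eigenvectorUnitary
  have hG : Xᵀ * X = W * Matrix.diagonal d * Wᵀ := by
    have := h.spectral_theorem
    rw [Unitary.conjStarAlgAut_apply] at this
    rw [hW, hd]; exact this
  obtain ⟨P, hP⟩ : ∃ P : Matrix (Fin r) (Fin r) ℝ,
      P = W * Matrix.diagonal (fun i => (d i)⁻¹) * Wᵀ := ⟨_, rfl⟩
  have hp : pinv X = P * Xᵀ := by rw [hP, hW, hd]; rfl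
  have hPT : Pᵀ = P := by
    rw [hP]; simp [Matrix.transpose_mul, Matrix.mul_assoc]
  have hGP : Xᵀ * X * P = W * Matrix.diagonal (fun i => d i * (d i)⁻¹) * Wᵀ := by
    rw [hG, hP, ← Matrix.diagonal_mul_diagonal]
    calc _ = W * Matrix.diagonal d * (Wᵀ * W) * Matrix.diagonal (fun i => (d i)⁻¹) * Wᵀ := by
          simp only [Matrix.mul_assoc]
      _ = _ := by rw [hWW]; simp only [Matrix.mul_assoc, Matrix.mul_one]
  have hPG : P * (Xᵀ * X) = W * Matrix.diagonal (fun i => d i * (d i)⁻¹) * Wᵀ := by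
    have := congrArg Matrix.transpose hGP
    simpa [Matrix.transpose_mul, hPT, Matrix.mul_assoc] using this
  have hGPG : Xᵀ * X * P * (Xᵀ * X) = Xᵀ * X := by
    rw [hGP, hG]
    calc _ = W * Matrix.diagonal (fun i => d i * (d i)⁻¹) * (Wᵀ * W) * Matrix.diagonal d * Wᵀ := by
          simp only [Matrix.mul_assoc]
      _ = W * (Matrix.diagonal (fun i => d i * (d i)⁻¹) * Matrix.diagonal d) * Wᵀ := by
          rw [hWW]; simp only [Matrix.mul_assoc, Matrix.one_mul]
      _ = _ := by
          rw [Matrix.diagonal_mul_diagonal]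
          simp only [mul_inv_mul_cancel]
  have hPGP : P * (Xᵀ * X) * P = P := by
    rw [hPG]
    conv_lhs => rw [hP]
    conv_rhs => rw [hP]
    calc _ = W * Matrix.diagonal (fun i => d i * (d i)⁻¹) * (Wᵀ * W) *
            Matrix.diagonal (fun i => (d i)⁻¹) * Wᵀ := by
          simp only [Matrix.mul_assoc]
      _ = W * (Matrix.diagonal (fun i => d i * (d i)⁻¹) *
            Matrix.diagonal (fun i => (d i)⁻¹)) * Wᵀ := by
          rw [hWW]; simp only [Matrix.mul_assoc, Matrix.one_mul]
      _ = _ := by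
          rw [Matrix.diagonal_mul_diagonal]
          congr 3; ext i
          by_cases h0 : d i = 0 <;> simp [h0]
  have hX : X * (P * (Xᵀ * X)) = X := by
    rw [← sub_eq_zero, ← Matrix.conjTranspose_mul_self_eq_zero]
    simp only [Matrix.conjTranspose_eq_transpose_of_trivial, Matrix.transpose_sub,
      Matrix.transpose_mul, Matrix.transpose_transpose, hPT]
    have e1 : Xᵀ * X * P * Xᵀ * (X * (P * (Xᵀ * X))) = Xᵀ * X := by
      calc _ = Xᵀ * X * P * (Xᵀ * X) * P * (Xᵀ * X) := by simp only [Matrix.mul_assoc]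
        _ = _ := by rw [hGPG, hGPG]
    have e2 : Xᵀ * (X * (P * (Xᵀ * X))) = Xᵀ * X := by
      simpa only [Matrix.mul_assoc] using hGPG
    have e3 : Xᵀ * X * P * Xᵀ * X = Xᵀ * X := by
      simpa only [Matrix.mul_assoc] using hGPG
    rw [Matrix.sub_mul, Matrix.mul_sub, Matrix.mul_sub, e1, e2, e3]
    simp
  rw [hp]
  refine ⟨?_, ?_, ?_, ?_⟩
  · simpa only [Matrix.mul_assoc] using hX
  · calc _ = P * (Xᵀ * X) * P * Xᵀ := by simp only [Matrix.mul_assoc]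
      _ = _ := by rw [hPGP]
  · simp [Matrix.transpose_mul, hPT, Matrix.mul_assoc]
  · rw [Matrix.mul_assoc P, hPG]
    simp [Matrix.transpose_mul, Matrix.mul_assoc]

/-- The smallest of the `min n r` singular values of an `n × r` matrix (they are listed in
decreasing order, starting from index `0`). -/
def sigmaMin {n r : ℕ} (X : Matrix (Fin n) (Fin r) ℝ) : ℝ :=
  (Matrix.toEuclideanLin X).singularValues (min n r - 1)

/-- The restricted isometry property `(δ, p)`-RIP. Here `‖E‖` is the Frobenius norm and `‖A E‖` the
Euclidean norm. -/
def SatisfiesRIP {n m : ℕ} (δ : ℝ) (p : ℕ)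
    (A : Matrix (Fin n) (Fin n) ℝ →ₗ[ℝ] EuclideanSpace ℝ (Fin m)) : Prop :=
  0 ≤ δ ∧ δ < 1 ∧ ∃ ν : ℝ, 0 < ν ∧ ∀ E : Matrix (Fin n) (Fin n) ℝ, E.rank ≤ p →
    (1 - δ) * ‖E‖ ^ 2 ≤ 1 / ν * ‖A E‖ ^ 2 ∧ 1 / ν * ‖A E‖ ^ 2 ≤ (1 + δ) * ‖E‖ ^ 2

/-- The objective `f(X) = ‖A(X Xᵀ) - b‖²` with measurements `b = A(Z Zᵀ)`. -/
def objective {n r m : ℕ} (A : Matrix (Fin n) (Fin n) ℝ →ₗ[ℝ] EuclideanSpace ℝ (Fin m))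
    (Z X : Matrix (Fin n) (Fin r) ℝ) : ℝ :=
  ‖A (X * Xᵀ) - A (Z * Zᵀ)‖ ^ 2

/-- `∇f(X) = 0` and `∇²f(X) ⪰ 0`. -/
def IsSecondOrderCritical {n r : ℕ} (f : Matrix (Fin n) (Fin r) ℝ → ℝ)
    (X : Matrix (Fin n) (Fin r) ℝ) : Prop :=
  fderiv ℝ f X = 0 ∧ ∀ V : Matrix (Fin n) (Fin r) ℝ, 0 ≤ fderiv ℝ (fderiv ℝ f) X V V

/-- The threshold `δ_p(X, Z)`: the smallest RIP constant (for matrices of rank at most `p`) of a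
linear operator, with any number `m` of measurements, for which `X` is a second-order critical
point. All RIP constants lie in `[0, 1)`; the threshold is `1` if no such operator exists. -/
def ripThresholdOfRank {n r : ℕ} (p : ℕ) (X Z : Matrix (Fin n) (Fin r) ℝ) : ℝ :=
  sInf (insert 1 {δ : ℝ | ∃ (m : ℕ)
    (A : Matrix (Fin n) (Fin n) ℝ →ₗ[ℝ] EuclideanSpace ℝ (Fin m)),
    IsSecondOrderCritical (objective A Z) X ∧ SatisfiesRIP δ p A})

/-- The RIP threshold function `δ(X, Z) = δ_{r + r⋆}(X, Z)`, where `r⋆ = rank Z`. -/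
def ripThreshold {n r : ℕ} (X Z : Matrix (Fin n) (Fin r) ℝ) : ℝ :=
  ripThresholdOfRank (r + Z.rank) X Z

/-- `Z_⊥ = (I - X X†) Z`. -/
def perp {n r : ℕ} (X Z : Matrix (Fin n) (Fin r) ℝ) : Matrix (Fin n) (Fin r) ℝ :=
  (1 - X * pinv X) * Z

/-- `α(X, Z) = ‖Z_⊥ Z_⊥ᵀ‖_F / ‖X Xᵀ - Z Zᵀ‖_F`. -/
def alpha {n r : ℕ} (X Z : Matrix (Fin n) (Fin r) ℝ) : ℝ :=
  ‖perp X Z * (perp X Z)ᵀ‖ / ‖X * Xᵀ - Z * Zᵀ‖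

/-- `β(X, Z) = (σ_min(X)² / ‖X Xᵀ - Z Zᵀ‖_F) (tr(Z_⊥ Z_⊥ᵀ) / ‖Z_⊥ Z_⊥ᵀ‖_F)`, which is `0` here
when `Z_⊥ = 0`. -/
def beta {n r : ℕ} (X Z : Matrix (Fin n) (Fin r) ℝ) : ℝ :=
  sigmaMin X ^ 2 / ‖X * Xᵀ - Z * Zᵀ‖ *
    ((perp X Z * (perp X Z)ᵀ).trace / ‖perp X Z * (perp X Z)ᵀ‖)

/-- The function `γ(α, β)`. -/
def gammaFun (α β : ℝ) : ℝ :=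
  if α / (1 + √(1 - α ^ 2)) ≤ β then √(1 - α ^ 2)
  else (1 - 2 * α * β + β ^ 2) / (1 - β ^ 2)

end

end MatrixSensing

/-! Write e = XXᵀ − ZZᵀ, N = Z_⊥Z_⊥ᵀ, B(E,F) = ⟨A E, A F⟩/ν, g = B(e,e). As Z_⊥ has the form Z + XC,
the sum e + N has the form XVᵀ + VXᵀ (`exists_residual_add_perp`). Every such matrix is orthogonal
to N because XᵀZ_⊥ = 0, so ⟨e,N⟩ = −‖N‖². Stationarity makes it B-orthogonal to e, so B(e,N) = −g
(`inner_map_perp_eq`). The Hessian along uvᵀ, summed over the columns u of Z_⊥, gives g ≤ (1+δ)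
σ_min² tr N (`neg_le_inner_map_perp`).

All matrices in span{e,N} have rank at most r + rank Z, so there B differs from the Frobenius
product by a form of norm at most δ. On this span −(g/‖N‖²)N represents B(e,·), hence ‖e +
(g/‖N‖²)N‖ ≤ δ‖e‖. With t = g/(‖e‖‖N‖) this reads 1 − 2tα + t² ≤ δ², where t ≤ (1+δ)β. The least
such δ is γ(α,β): the optimum is t = α if the constraint allows it, and t = (1+δ)β otherwise
(`gammaFun_le`). -/

/-! ### Derivatives of the squared norm of a quadratic map. -/

theorem fderiv_norm_sq_bilin {E F : Type*} [NormedAddCommGroup E] [NormedSpace ℝ E]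
    [NormedAddCommGroup F] [InnerProductSpace ℝ F] (β : E →L[ℝ] E →L[ℝ] F) (b : F) (x v : E) :
    fderiv ℝ (fun y => ‖β y y - b‖ ^ 2) x v = 2 * inner ℝ (β x x - b) (β x v + β v x) := by
  have h1 : HasFDerivAt (fun y => β y y - b) (β x + β.flip x) x := by
    have := ((β.hasFDerivAt (x := x)).clm_apply (hasFDerivAt_id x)).sub_const b
    simpa using this
  have h := h1.norm_sq
  rw [h.fderiv]
  simp [inner_add_right, inner_sub_left]
  ring

theorem fderiv_fderiv_norm_sq_bilin {E F : Type*} [NormedAddCommGroup E] [NormedSpace ℝ E]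
    [NormedAddCommGroup F] [InnerProductSpace ℝ F] (β : E →L[ℝ] E →L[ℝ] F) (b : F) (x v : E) :
    fderiv ℝ (fderiv ℝ (fun y => ‖β y y - b‖ ^ 2)) x v v =
      2 * ‖β x v + β v x‖ ^ 2 + 4 * inner ℝ (β x x - b) (β v v) := by
  have hc : ContDiff ℝ 2 (fun y => ‖β y y - b‖ ^ 2) := by
    have : ContDiff ℝ 2 (fun y => β y y - b) := by fun_prop
    exact this.norm_sq ℝ
  have hd : DifferentiableAt ℝ (fderiv ℝ (fun y => ‖β y y - b‖ ^ 2)) x :=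
    ((hc.fderiv_right (m := 1) (by norm_num)).differentiable (by norm_num)) x
  have h1 : HasFDerivAt (fun y => β y y - b) (β x + β.flip x) x := by
    have := ((β.hasFDerivAt (x := x)).clm_apply (hasFDerivAt_id x)).sub_const b
    simpa using this
  have h2 : HasFDerivAt (fun y => β y v + β v y) (β.flip v + β v) x :=
    (β.flip v).hasFDerivAt.add (β v).hasFDerivAt
  have h3 := (h1.inner ℝ h2).const_mul 2
  -- The Hessian at `(v, v)` is the derivative in direction `v` of the scalar function `y ↦ f'(y)
  -- v`, with `v` frozen.
  have e1 := (hd.hasFDerivAt.clm_apply (hasFDerivAt_const v x)).fderiv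
  have e2 : (fun y => fderiv ℝ (fun y => ‖β y y - b‖ ^ 2) y v) =
      fun y => 2 * inner ℝ (β y y - b) (β y v + β v y) :=
    funext fun y => fderiv_norm_sq_bilin β b y v
  rw [e2, h3.fderiv] at e1
  have e3 := congrArg (fun L => L v) e1
  simp only [add_apply, ContinuousLinearMap.flip_apply,
    ContinuousLinearMap.comp_zero, zero_add,
    smul_apply, ContinuousLinearMap.comp_apply, smul_eq_mul,
    ContinuousLinearMap.prod_apply, fderivInnerCLM_apply] at e3
  rw [← e3, ← real_inner_self_eq_norm_sq, ← two_smul ℝ (β v v), real_inner_smul_right]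
  ring

/-! ### Matrix algebra of the residual, and rank bounds. -/

/-- The two `Z * Zᵀ` terms cancel and every remaining term has a factor `X` on the left or `Xᵀ` on
the right. The witness takes half of each symmetric term and one of the two cross terms. -/
theorem exists_sub_add_residual_eq {K ι κ : Type*} [Field K] [CharZero K] [Fintype κ]
    (X Z : Matrix ι κ K) (C : Matrix κ κ K) :
    ∃ V : Matrix ι κ K, X * Xᵀ - Z * Zᵀ + (Z - X * C) * (Z - X * C)ᵀ = X * Vᵀ + V * Xᵀ := by
  refine ⟨(1 / 2 : K) • X - Z * Cᵀ + (1 / 2 : K) • (X * (C * Cᵀ)), ?_⟩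
  simp only [Matrix.transpose_sub, Matrix.transpose_add, Matrix.transpose_mul,
    Matrix.transpose_smul, Matrix.transpose_transpose, Matrix.mul_sub, Matrix.sub_mul,
    Matrix.mul_add, Matrix.add_mul, Matrix.mul_smul, Matrix.smul_mul, Matrix.mul_assoc]
  module

/-- The columns lie in range X + range Z. This is what makes the RIP of order r + rank Z applicable
to every matrix tested below. -/
theorem rank_mul_add_mul_le {K : Type*} [Field K] {n r k : ℕ}
    (X Z : Matrix (Fin n) (Fin r) K) (M N : Matrix (Fin r) (Fin k) K) :
    (X * M + Z * N).rank ≤ r + Z.rank := by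
  have h : (X * M + Z * N).rank ≤ (X * M).rank + (Z * N).rank := by
    rw [Matrix.rank, Matrix.mulVecLin_add, Matrix.rank, Matrix.rank]
    refine (Submodule.finrank_mono (LinearMap.range_add_le _ _)).trans ?_
    exact Submodule.finrank_add_le_finrank_add_finrank _ _
  refine h.trans (add_le_add ?_ (Matrix.rank_mul_le_left _ _))
  exact (Matrix.rank_mul_le_left _ _).trans (Matrix.rank_le_width X)

namespace MatrixSensing

variable {n r m : ℕ}

/-! ### The objective, Z_⊥ and the singular vector. -/

theorem fderiv_objective (A : Matrix (Fin n) (Fin n) ℝ →ₗ[ℝ] EuclideanSpace ℝ (Fin m))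
    (X Z V : Matrix (Fin n) (Fin r) ℝ) :
    fderiv ℝ (objective A Z) X V =
      2 * inner ℝ (A (X * Xᵀ - Z * Zᵀ)) (A (X * Vᵀ + V * Xᵀ)) ∧
    fderiv ℝ (fderiv ℝ (objective A Z)) X V V =
      2 * ‖A (X * Vᵀ + V * Xᵀ)‖ ^ 2 + 4 * inner ℝ (A (X * Xᵀ - Z * Zᵀ)) (A (V * Vᵀ)) := by
  let b : Matrix (Fin n) (Fin r) ℝ →ₗ[ℝ] Matrix (Fin n) (Fin r) ℝ →ₗ[ℝ]
      EuclideanSpace ℝ (Fin m) :=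
    LinearMap.mk₂ ℝ (fun X Y => A (X * Yᵀ))
      (by intros; simp [Matrix.add_mul]) (by intros; simp)
      (by intros; simp [Matrix.mul_add]) (by intros; simp)
  have hf : objective A Z =
      fun Y => ‖b.toContinuousBilinearMap Y Y - A (Z * Zᵀ)‖ ^ 2 := rfl
  rw [hf]
  refine ⟨(fderiv_norm_sq_bilin _ _ X V).trans ?_, (fderiv_fderiv_norm_sq_bilin _ _ X V).trans ?_⟩ <;>
  simp only [map_add, map_sub] <;> rfl

theorem norm_sq_eq_trace {p q : ℕ} (E : Matrix (Fin p) (Fin q) ℝ) :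
    ‖E‖ ^ 2 = (Eᵀ * E).trace := by
  rw [Matrix.frobenius_norm_def, ← Real.sqrt_eq_rpow, Real.sq_sqrt (by positivity),
    Finset.sum_comm]
  simp [Matrix.trace, Matrix.mul_apply, pow_two]

theorem transpose_mul_perp (X Z : Matrix (Fin n) (Fin r) ℝ) : Xᵀ * perp X Z = 0 := by
  obtain ⟨h1, -, h3, -⟩ := pinv_penrose X
  have : Xᵀ * (X * pinv X) = Xᵀ := by
    rw [← h3, ← Matrix.transpose_mul, h1]
  rw [perp, ← Matrix.mul_assoc, Matrix.mul_sub, this]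
  simp

theorem exists_residual_add_perp (X Z : Matrix (Fin n) (Fin r) ℝ) :
    ∃ V : Matrix (Fin n) (Fin r) ℝ,
      X * Xᵀ - Z * Zᵀ + perp X Z * (perp X Z)ᵀ = X * Vᵀ + V * Xᵀ := by
  have hC : perp X Z = Z - X * (pinv X * Z) := by
    rw [perp, Matrix.sub_mul, Matrix.one_mul, Matrix.mul_assoc]
  rw [hC]
  exact exists_sub_add_residual_eq X Z (pinv X * Z)

theorem exists_perp_eq (X Z : Matrix (Fin n) (Fin r) ℝ) : ∃ C : Matrix (Fin r) (Fin r) ℝ, perp X Z = X * C + Z := by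
  refine ⟨-(pinv X * Z), ?_⟩
  rw [perp, Matrix.sub_mul, Matrix.one_mul, Matrix.mul_assoc, Matrix.mul_neg]
  abel

/-- An eigenvector of XᵀX works; only that `sigmaMin X` is some singular value matters, not that it
is the smallest. -/
theorem exists_unit_norm_sq_mulVec_eq_sigmaMin_sq (hr : 0 < r) (X : Matrix (Fin n) (Fin r) ℝ) :
    ∃ v : Fin r → ℝ, v ⬝ᵥ v = 1 ∧ (X *ᵥ v) ⬝ᵥ (X *ᵥ v) = sigmaMin X ^ 2 := by
  -- For `n = 0` the subtraction truncates to index `0`, still valid since `0 < r`.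
  have hlt : min n r - 1 < Module.finrank ℝ (EuclideanSpace ℝ (Fin r)) := by
    simp; omega
  let T := Matrix.toEuclideanLin X
  let w := T.isSymmetric_adjoint_comp_self.eigenvectorBasis rfl ⟨_, hlt⟩
  have hw : ‖w‖ = 1 := OrthonormalBasis.norm_eq_one _ _
  have hTw : ‖T w‖ ^ 2 = sigmaMin X ^ 2 := by
    have h := T.isSymmetric_adjoint_comp_self.apply_eigenvectorBasis rfl ⟨_, hlt⟩
    rw [← T.sq_singularValues_fin] at h
    rw [← real_inner_self_eq_norm_sq, ← LinearMap.adjoint_inner_left]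
    change inner ℝ ((LinearMap.adjoint T ∘ₗ T) w) w = _
    rw [h]
    simp only [RCLike.ofReal_real_eq_id, id]
    rw [real_inner_smul_left, real_inner_self_eq_norm_sq]
    change _ * ‖w‖ ^ 2 = _
    rw [hw]
    simp [sigmaMin, T]
  refine ⟨w.ofLp, ?_, ?_⟩
  · have := EuclideanSpace.real_norm_sq_eq w
    rw [hw] at this
    simpa [dotProduct, pow_two] using this.symm
  · rw [← hTw, EuclideanSpace.real_norm_sq_eq]
    simp [dotProduct, pow_two, T]

theorem norm_sq_vecMulVec_add (a u : Fin n → ℝ) (h : a ⬝ᵥ u = 0) :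
    ‖Matrix.vecMulVec a u + Matrix.vecMulVec u a‖ ^ 2 = 2 * (a ⬝ᵥ a) * (u ⬝ᵥ u) := by
  have h' : u ⬝ᵥ a = 0 := by rw [dotProduct_comm, h]
  rw [norm_sq_eq_trace]
  simp only [Matrix.transpose_add, Matrix.transpose_vecMulVec, Matrix.add_mul, Matrix.mul_add,
    Matrix.vecMulVec_mul_vecMulVec, h, h', Matrix.trace_add, Matrix.trace_vecMulVec,
    Matrix.vecMulVec_smul, Matrix.trace_smul, smul_eq_mul]
  ring

end MatrixSensing

/-! ### Polarization of the RIP on a plane. -/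

/-- Polarization: if a quadratic form `b` on a plane is within relative error `δ` of a positive
semidefinite form `c`, then so are the off-diagonal entries. -/
theorem sq_offDiag_sub_le_of_forall_abs_le {δ bee bef bff cee cef cff : ℝ} (hcee : 0 < cee)
    (hcff : 0 ≤ cff)
    (hl : ∀ x y : ℝ, (1 - δ) * (x ^ 2 * cee + 2 * (x * y) * cef + y ^ 2 * cff) ≤
      x ^ 2 * bee + 2 * (x * y) * bef + y ^ 2 * bff)
    (hu : ∀ x y : ℝ, x ^ 2 * bee + 2 * (x * y) * bef + y ^ 2 * bff ≤
      (1 + δ) * (x ^ 2 * cee + 2 * (x * y) * cef + y ^ 2 * cff)) :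
    (bef - cef) ^ 2 ≤ δ ^ 2 * (cee * cff) := by
  obtain ⟨p, hp, rfl⟩ : ∃ p : ℝ, 0 < p ∧ p ^ 2 = cee :=
    ⟨√cee, Real.sqrt_pos.2 hcee, Real.sq_sqrt hcee.le⟩
  obtain ⟨q, hq, rfl⟩ : ∃ q : ℝ, 0 ≤ q ∧ q ^ 2 = cff := ⟨√cff, by positivity, Real.sq_sqrt hcff⟩
  -- Comparing the lower bound at one of `(1, ±y)` with the upper bound at the other cancels `bee`
  -- and `bff`.
  have key : ∀ y : ℝ, 2 * |y * (bef - cef)| ≤ δ * (p ^ 2 + y ^ 2 * q ^ 2) := by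
    intro y
    have h1 := hl 1 y
    have h2 := hu 1 y
    have h3 := hl 1 (-y)
    have h4 := hu 1 (-y)
    rw [← le_div_iff₀' (by norm_num)]
    refine abs_le.2 ⟨?_, ?_⟩ <;> nlinarith
  have hδ : 0 ≤ δ := by
    have := key 0
    simp only [zero_mul, abs_zero, mul_zero] at this
    nlinarith [pow_pos hp 2]
  rcases hq.eq_or_lt with rfl | hq
  -- When `cff = 0` the right side of `key` does not depend on `y`, so a large `y` forces the defect
  -- to vanish.
  · have : bef - cef = 0 := by
      by_contra h
      have := key ((δ * p ^ 2 + 1) / (bef - cef))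
      rw [div_mul_cancel₀ _ h, abs_of_pos (by positivity)] at this
      nlinarith [mul_nonneg hδ (sq_nonneg p)]
    simp [this]
  -- This `y` balances the two terms `p ^ 2` and `y ^ 2 * q ^ 2`.
  · have := key (p / q)
    rw [abs_mul, abs_of_pos (by positivity), div_pow, div_mul_cancel₀ _ (by positivity)] at this
    have h : |bef - cef| ≤ δ * (p * q) := by
      have h2 : p * |bef - cef| ≤ δ * p ^ 2 * q := by
        rw [← div_le_iff₀ hq]
        calc _ = p / q * |bef - cef| := by ring
          _ ≤ _ := by linarith
      nlinarith
    calc _ = |bef - cef| ^ 2 := (sq_abs _).symm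
      _ ≤ (δ * (p * q)) ^ 2 := by gcongr
      _ = _ := by ring

namespace MatrixSensing

variable {n r m : ℕ}

/-! ### The scalar optimization defining γ. -/

theorem gammaFun_le_one {α β : ℝ} (hα : α ≤ 1) (hβ : 0 ≤ β) : gammaFun α β ≤ 1 := by
  unfold gammaFun
  split_ifs with h
  · rw [Real.sqrt_le_left zero_le_one]
    nlinarith [sq_nonneg α]
  · have hs := Real.sqrt_nonneg (1 - α ^ 2)
    rw [not_le, lt_div_iff₀ (by positivity)] at h
    have hβα : β < α := by nlinarith
    rw [div_le_one (by nlinarith)]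
    nlinarith

theorem gammaFun_le {α β δ t : ℝ} (hα : 0 < α) (hα1 : α ≤ 1) (hβ : 0 ≤ β) (hδ : 0 ≤ δ)
    (ht : t ≤ (1 + δ) * β) (h : 1 - 2 * t * α + t ^ 2 ≤ δ ^ 2) : gammaFun α β ≤ δ := by
  unfold gammaFun
  split_ifs with hc
  · rw [Real.sqrt_le_left hδ]
    -- Unconstrained minimum: 1 − 2tα + t² = (t − α)² + 1 − α².
    nlinarith [sq_nonneg (t - α)]
  · obtain ⟨s, hs⟩ : ∃ s, s = √(1 - α ^ 2) := ⟨_, rfl⟩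
    have hs0 : 0 ≤ s := by rw [hs]; positivity
    have hs2 : s ^ 2 = 1 - α ^ 2 := by rw [hs]; exact Real.sq_sqrt (by nlinarith)
    rw [← hs, not_le, lt_div_iff₀ (by positivity)] at hc
    have hβα : β * 1 ≤ α := by nlinarith
    have hβ1 : β < 1 := by
      rcases hs0.eq_or_lt with h0 | h0
      · rw [← h0] at hc; linarith
      · nlinarith
    rw [div_le_iff₀ (by nlinarith)]
    -- If the bound on `t` lies left of the vertex `α`, the quadratic may be evaluated at that
    -- bound, and a factor `1 + δ` splits off. Otherwise `δ > α / β - 1` (for β > 0), which already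
    -- exceeds γ by `h1`.
    by_cases hm : (1 + δ) * β ≤ α
    · have h1 : 1 - 2 * ((1 + δ) * β) * α + ((1 + δ) * β) ^ 2 ≤ δ ^ 2 := by nlinarith
      have h2 : (1 + δ) * (1 - 2 * α * β + (1 + δ) * β ^ 2 - δ) ≤ 0 := by linarith
      have h3 : 1 - 2 * α * β + (1 + δ) * β ^ 2 - δ ≤ 0 := by
        by_contra h4
        nlinarith [mul_pos (by linarith : 0 < 1 + δ) (not_le.1 h4)]
      linarith
    · have h1 : 0 ≤ α * β ^ 2 - 2 * β + α := by
        have h2 : α * β ≤ 1 - s :=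
          le_of_mul_le_mul_right (a := 1 + s) (by nlinarith) (by linarith)
        -- After multiplication by `α` the expression is (1 − αβ)² − s², which factors.
        refine nonneg_of_mul_nonneg_left (b := α) ?_ hα
        have h3 : 0 ≤ (1 - s - α * β) * (1 + s - α * β) :=
          mul_nonneg (by linarith) (by linarith)
        nlinarith
      rw [not_le] at hm
      rcases hβ.eq_or_lt with h0 | h0
      · rw [← h0] at hm; linarith
      · have : 0 ≤ β * (δ * (1 - β ^ 2) - (1 - 2 * α * β + β ^ 2)) := by
          have h5 : 0 < 1 - β ^ 2 := by nlinarith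
          nlinarith [mul_pos (sub_pos.2 hm) h5]
        nlinarith
-- Frobenius geometry of the residual and Z_⊥Z_⊥ᵀ.
/-- Expansion of a squared Frobenius norm, with inner product `trace (Eᵀ * F)`. -/
theorem norm_sq_smul_add_smul {p q : ℕ} (E F : Matrix (Fin p) (Fin q) ℝ) (x y : ℝ) :
    ‖x • E + y • F‖ ^ 2 =
      x ^ 2 * ‖E‖ ^ 2 + 2 * (x * y) * (Eᵀ * F).trace + y ^ 2 * ‖F‖ ^ 2 := by
  have h : (Fᵀ * E).trace = (Eᵀ * F).trace := by
    rw [← Matrix.trace_transpose, Matrix.transpose_mul, Matrix.transpose_transpose]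
  simp only [norm_sq_eq_trace, Matrix.transpose_add, Matrix.transpose_smul, Matrix.add_mul,
    Matrix.mul_add, Matrix.smul_mul, Matrix.mul_smul, Matrix.trace_add, Matrix.trace_smul,
    smul_eq_mul, h]
  ring

theorem trace_transpose_residual_mul_perp (X Z : Matrix (Fin n) (Fin r) ℝ) :
    ((X * Xᵀ - Z * Zᵀ)ᵀ * (perp X Z * (perp X Z)ᵀ)).trace =
      -‖perp X Z * (perp X Z)ᵀ‖ ^ 2 := by
  obtain ⟨V, hV⟩ := exists_residual_add_perp X Z
  have h1 := transpose_mul_perp X Z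
  have h2 : (perp X Z)ᵀ * X = 0 := by
    simpa [Matrix.transpose_mul] using congrArg Matrix.transpose h1
  obtain ⟨P, hP⟩ : ∃ P, P = perp X Z := ⟨_, rfl⟩
  rw [← hP] at h1 h2 hV ⊢
  rw [eq_sub_of_add_eq hV, norm_sq_eq_trace]
  simp only [Matrix.transpose_sub, Matrix.transpose_add, Matrix.transpose_mul,
    Matrix.transpose_transpose, Matrix.sub_mul, Matrix.add_mul, Matrix.trace_sub,
    Matrix.trace_add]
  have h3 : V * Xᵀ * (P * Pᵀ) = 0 := by
    rw [Matrix.mul_assoc, ← Matrix.mul_assoc Xᵀ, h1]; simp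
  have h4 : (X * Vᵀ * (P * Pᵀ)).trace = 0 := by
    rw [Matrix.trace_mul_comm, Matrix.mul_assoc, ← Matrix.mul_assoc Pᵀ, h2]; simp
  rw [h3, h4]
  simp

/-- By the trace identity, ‖e + N‖² = ‖e‖² − ‖N‖², which is nonnegative. -/
theorem norm_perp_mul_transpose_le (X Z : Matrix (Fin n) (Fin r) ℝ) :
    ‖perp X Z * (perp X Z)ᵀ‖ ≤ ‖X * Xᵀ - Z * Zᵀ‖ := by
  have h := norm_sq_smul_add_smul (X * Xᵀ - Z * Zᵀ) (perp X Z * (perp X Z)ᵀ) 1 1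
  rw [trace_transpose_residual_mul_perp] at h
  refine le_of_sq_le_sq ?_ (norm_nonneg _)
  nlinarith [sq_nonneg ‖(1 : ℝ) • (X * Xᵀ - Z * Zᵀ) + (1 : ℝ) • (perp X Z * (perp X Z)ᵀ)‖]

theorem mul_transpose_eq_sum_vecMulVec {p q : ℕ} (P : Matrix (Fin p) (Fin q) ℝ) :
    P * Pᵀ = ∑ j, Matrix.vecMulVec (P.col j) (P.col j) := by
  ext a b
  simp [Matrix.mul_apply, Matrix.sum_apply, Matrix.vecMulVec_apply]

/-! ### Consequences of the two stationarity conditions. -/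

/-- Second-order stationarity, tested on the directions `u vᵀ` for `u` a column of `Z_⊥` and `v`
a right singular vector of `X` for `sigmaMin X`. -/
theorem neg_le_inner_map_perp {δ ν : ℝ} (hν : 0 < ν)
    (A : Matrix (Fin n) (Fin n) ℝ →ₗ[ℝ] EuclideanSpace ℝ (Fin m))
    (X Z : Matrix (Fin n) (Fin r) ℝ)
    (hX : ∀ V : Matrix (Fin n) (Fin r) ℝ, 0 ≤ fderiv ℝ (fderiv ℝ (objective A Z)) X V V)
    (hA : ∀ E : Matrix (Fin n) (Fin n) ℝ, E.rank ≤ r + Z.rank →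
      1 / ν * ‖A E‖ ^ 2 ≤ (1 + δ) * ‖E‖ ^ 2) :
    -((1 + δ) * (sigmaMin X ^ 2 * (perp X Z * (perp X Z)ᵀ).trace)) ≤
      1 / ν * inner ℝ (A (X * Xᵀ - Z * Zᵀ)) (A (perp X Z * (perp X Z)ᵀ)) := by
  -- For `r = 0` there is no unit vector `v`, but both sides vanish.
  rcases r.eq_zero_or_pos with rfl | hr
  · have : perp X Z * (perp X Z)ᵀ = 0 := by ext; simp [Matrix.mul_apply]
    rw [this]
    simp
  obtain ⟨v, hv, hXv⟩ := exists_unit_norm_sq_mulVec_eq_sigmaMin_sq hr X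
  obtain ⟨C, hC⟩ := exists_perp_eq X Z
  have h1 := transpose_mul_perp X Z
  obtain ⟨P, hP⟩ : ∃ P, P = perp X Z := ⟨_, rfl⟩
  rw [← hP] at h1 hC ⊢
  have key : ∀ j, -((1 + δ) * (sigmaMin X ^ 2 * (P.col j ⬝ᵥ P.col j))) ≤
      1 / ν * inner ℝ (A (X * Xᵀ - Z * Zᵀ)) (A (Matrix.vecMulVec (P.col j) (P.col j))) := by
    intro j
    obtain ⟨u, hu⟩ : ∃ u, u = P.col j := ⟨_, rfl⟩
    have hPu : P *ᵥ Pi.single j 1 = u := by rw [hu]; simp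
    have hort : (X *ᵥ v) ⬝ᵥ u = 0 := by
      rw [← hPu, Matrix.dotProduct_mulVec, ← Matrix.vecMul_transpose,
        Matrix.vecMul_vecMul, h1]
      simp
    have h := hX (Matrix.vecMulVec u v)
    have e1 : X * (Matrix.vecMulVec u v)ᵀ + Matrix.vecMulVec u v * Xᵀ =
        Matrix.vecMulVec (X *ᵥ v) u + Matrix.vecMulVec u (X *ᵥ v) := by
      rw [Matrix.transpose_vecMulVec, Matrix.mul_vecMulVec, Matrix.vecMulVec_mul,
        Matrix.vecMul_transpose]
    have e2 : Matrix.vecMulVec u v * (Matrix.vecMulVec u v)ᵀ = Matrix.vecMulVec u u := by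
      rw [Matrix.transpose_vecMulVec, Matrix.vecMulVec_mul_vecMulVec, hv, one_smul]
    rw [(fderiv_objective A X Z _).2, e1, e2] at h
    have hrank : (Matrix.vecMulVec (X *ᵥ v) u + Matrix.vecMulVec u (X *ᵥ v)).rank ≤
        r + Z.rank := by
      -- The column `u` is `(X * C + Z) *ᵥ Pi.single j 1`, so all columns lie in range X + range Z.
      have : Matrix.vecMulVec (X *ᵥ v) u + Matrix.vecMulVec u (X *ᵥ v) =
          X * (Matrix.vecMulVec v u + C * Matrix.vecMulVec (Pi.single j 1) (X *ᵥ v)) +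
            Z * Matrix.vecMulVec (Pi.single j 1) (X *ᵥ v) := by
        rw [Matrix.mul_add, Matrix.mul_vecMulVec, add_assoc, ← Matrix.mul_assoc,
          ← Matrix.add_mul, ← hC, Matrix.mul_vecMulVec, hPu]
      rw [this]
      exact rank_mul_add_mul_le _ _ _ _
    have h2 := hA _ hrank
    rw [norm_sq_vecMulVec_add _ _ hort, hXv] at h2
    rw [← hu]
    have h3 := mul_nonneg (one_div_pos.2 hν).le h
    linarith
  have h2 := Finset.sum_le_sum fun j (_ : j ∈ Finset.univ) => key j
  rw [← Finset.mul_sum, ← inner_sum, ← map_sum, ← mul_transpose_eq_sum_vecMulVec] at h2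
  refine le_trans (le_of_eq ?_) h2
  rw [mul_transpose_eq_sum_vecMulVec, Matrix.trace_sum]
  simp only [Matrix.trace_vecMulVec, Finset.mul_sum, Finset.sum_neg_distrib]

theorem inner_map_perp_eq (A : Matrix (Fin n) (Fin n) ℝ →ₗ[ℝ] EuclideanSpace ℝ (Fin m))
    (X Z : Matrix (Fin n) (Fin r) ℝ) (hX : fderiv ℝ (objective A Z) X = 0) :
    inner ℝ (A (X * Xᵀ - Z * Zᵀ)) (A (perp X Z * (perp X Z)ᵀ)) =
      -‖A (X * Xᵀ - Z * Zᵀ)‖ ^ 2 := by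
  obtain ⟨V, hV⟩ := exists_residual_add_perp X Z
  have h := (fderiv_objective A X Z V).1
  rw [hX, ← hV, map_add, inner_add_right, real_inner_self_eq_norm_sq] at h
  simp only [zero_apply] at h
  linarith

theorem beta_nonneg (X Z : Matrix (Fin n) (Fin r) ℝ) : 0 ≤ beta X Z := by
  have h : 0 ≤ (perp X Z * (perp X Z)ᵀ).trace := by
    have := norm_sq_eq_trace (perp X Z)ᵀ
    rw [Matrix.transpose_transpose] at this
    rw [← this]
    positivity
  unfold beta
  positivity

/-! ### Combination into the lower bound on δ. -/

theorem gammaFun_le_of_isSecondOrderCritical {δ : ℝ} {X Z : Matrix (Fin n) (Fin r) ℝ}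
    (hXZ : X * Xᵀ ≠ Z * Zᵀ) {A : Matrix (Fin n) (Fin n) ℝ →ₗ[ℝ] EuclideanSpace ℝ (Fin m)}
    (hX : IsSecondOrderCritical (objective A Z) X) (hA : SatisfiesRIP δ (r + Z.rank) A) :
    gammaFun (alpha X Z) (beta X Z) ≤ δ := by
  obtain ⟨hδ, hδ1, ν, hν, hA⟩ := hA
  have hN := neg_le_inner_map_perp hν A X Z hX.2 fun E hE => (hA E hE).2
  have hAN := inner_map_perp_eq A X Z hX.1
  have htr := trace_transpose_residual_mul_perp X Z
  have hle := norm_perp_mul_transpose_le X Z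
  have hbeta := beta_nonneg X Z
  have hrank : ∀ x y : ℝ,
      (x • (X * Xᵀ - Z * Zᵀ) + y • (perp X Z * (perp X Z)ᵀ)).rank ≤ r + Z.rank := by
    obtain ⟨C, hC⟩ := exists_perp_eq X Z
    intro x y
    have : x • (X * Xᵀ - Z * Zᵀ) + y • (perp X Z * (perp X Z)ᵀ) =
        X * (x • Xᵀ + y • (C * (perp X Z)ᵀ)) + Z * (y • (perp X Z)ᵀ - x • Zᵀ) := by
      conv_lhs => rw [hC, Matrix.add_mul, ← hC]
      simp only [Matrix.mul_add, Matrix.mul_sub, Matrix.mul_smul, Matrix.mul_assoc]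
      module
    rw [this]
    exact rank_mul_add_mul_le _ _ _ _
  have he : 0 < ‖X * Xᵀ - Z * Zᵀ‖ := norm_pos_iff.2 (sub_ne_zero.2 hXZ)
  unfold alpha
  unfold beta at hbeta ⊢
  obtain ⟨e, hedef⟩ : ∃ e, e = X * Xᵀ - Z * Zᵀ := ⟨_, rfl⟩
  obtain ⟨N, hNdef⟩ : ∃ N, N = perp X Z * (perp X Z)ᵀ := ⟨_, rfl⟩
  rw [← hedef] at he
  rw [← hedef, ← hNdef] at hbeta hN hAN htr hle hrank ⊢
  have hquad : ∀ x y : ℝ, 1 / ν * ‖A (x • e + y • N)‖ ^ 2 = x ^ 2 * (1 / ν * ‖A e‖ ^ 2) +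
      2 * (x * y) * (1 / ν * inner ℝ (A e) (A N)) + y ^ 2 * (1 / ν * ‖A N‖ ^ 2) := by
    intro x y
    rw [map_add, map_smul, map_smul, norm_add_sq_real, norm_smul, norm_smul, mul_pow, mul_pow,
      real_inner_smul_left, real_inner_smul_right, Real.norm_eq_abs, Real.norm_eq_abs, sq_abs,
      sq_abs]
    ring
  have hlow : ∀ x y : ℝ, _ := fun x y => (hA _ (hrank x y)).1
  have hupp : ∀ x y : ℝ, _ := fun x y => (hA _ (hrank x y)).2
  simp only [hquad, norm_sq_smul_add_smul, htr, hAN] at hlow hupp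
  rw [hAN] at hN
  obtain ⟨T, hT⟩ : ∃ T, T = sigmaMin X ^ 2 * N.trace := ⟨_, rfl⟩
  obtain ⟨g, hg⟩ : ∃ g, g = 1 / ν * ‖A e‖ ^ 2 := ⟨_, rfl⟩
  obtain ⟨w, hw⟩ : ∃ w, w = 1 / ν * ‖A N‖ ^ 2 := ⟨_, rfl⟩
  obtain ⟨c, hc⟩ : ∃ c, c = ‖e‖ := ⟨_, rfl⟩
  obtain ⟨k, hk⟩ : ∃ k, k = ‖N‖ := ⟨_, rfl⟩
  have hβ : sigmaMin X ^ 2 / c * (N.trace / k) = T / (c * k) := by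
    rw [hT, div_mul_div_comm]
  have hk0 : 0 ≤ k := hk ▸ norm_nonneg N
  simp only [mul_neg, ← hg, ← hw, ← hc, ← hk, ← hT] at hN hlow hupp hle he hbeta ⊢
  rw [hβ] at hbeta ⊢
  have hgpos : 0 < g := by
    have := hlow 1 0
    have : 0 < (1 - δ) * c ^ 2 := mul_pos (by linarith) (by positivity)
    linarith
  -- If Z_⊥ = 0, the Hessian bound gives g ≤ 0, contradicting the RIP lower bound for e ≠ 0.
  have hkpos : 0 < k := by
    refine hk0.lt_of_ne fun h => ?_
    have hN0 : N = 0 := norm_eq_zero.1 (hk.symm.trans h.symm)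
    have : T = 0 := by rw [hT, hN0]; simp
    rw [this] at hN
    linarith
  -- Polarization for e and f = e + (g/k²)N. Since −f represents B(e,·) − ⟨e,·⟩ on the span, this
  -- choice of second vector makes the estimate sharp.
  have hpol : ((1 - g / k ^ 2) * g - (c ^ 2 - g / k ^ 2 * k ^ 2)) ^ 2 ≤
      δ ^ 2 * (c ^ 2 * (c ^ 2 - 2 * (g / k ^ 2) * k ^ 2 + (g / k ^ 2) ^ 2 * k ^ 2)) := by
    refine sq_offDiag_sub_le_of_forall_abs_le (bee := g)
      (bff := g - 2 * (g / k ^ 2) * g + (g / k ^ 2) ^ 2 * w) (by positivity) ?_ ?_ ?_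
    · have : c ^ 2 - 2 * (g / k ^ 2) * k ^ 2 + (g / k ^ 2) ^ 2 * k ^ 2 =
          ‖(1 : ℝ) • e + (g / k ^ 2) • N‖ ^ 2 := by
        rw [norm_sq_smul_add_smul, htr, ← hc, ← hk]; ring
      rw [this]
      positivity
    · intro x y
      have := hlow (x + y) (y * (g / k ^ 2))
      linarith
    · intro x y
      have := hupp (x + y) (y * (g / k ^ 2))
      linarith
  obtain ⟨t, ht⟩ : ∃ t, t = g / (c * k) := ⟨_, rfl⟩
  obtain ⟨a, ha⟩ : ∃ a, a = k / c := ⟨_, rfl⟩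
  have hgt : g = t * (c * k) := by rw [ht]; field_simp
  have hka : k = a * c := by rw [ha]; field_simp
  have ha0 : 0 < a := by rw [ha]; positivity
  rw [← ha]
  refine gammaFun_le (t := t) ha0 ?_ hbeta hδ ?_ ?_
  · rw [ha]; exact div_le_one_of_le₀ hle he.le
  · rw [ht, ← mul_div_assoc]
    gcongr
    linarith
  -- The off-diagonal defect equals −‖f‖², so `hpol` says ‖f‖⁴ ≤ δ²c²‖f‖², and one factor ‖f‖²
  -- cancels when it is positive.
  · have e1 : ((1 - g / k ^ 2) * g - (c ^ 2 - g / k ^ 2 * k ^ 2)) =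
        -c ^ 2 * (1 - 2 * t * a + t ^ 2) := by
      rw [hgt, hka]; field_simp; ring
    have e2 : c ^ 2 - 2 * (g / k ^ 2) * k ^ 2 + (g / k ^ 2) ^ 2 * k ^ 2 =
        c ^ 2 * (1 - 2 * t * a + t ^ 2) := by
      rw [hgt, hka]; field_simp
    rw [e1, e2] at hpol
    by_contra! h
    have hpos : 0 < 1 - 2 * t * a + t ^ 2 := (sq_nonneg δ).trans_lt h
    have := mul_lt_mul_of_pos_left h (by positivity : 0 < c ^ 4 * (1 - 2 * t * a + t ^ 2))
    linarith

end MatrixSensing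

theorem theorem5 {n r : ℕ} (X Z : Matrix (Fin n) (Fin r) ℝ) (hXZ : X * Xᵀ ≠ Z * Zᵀ) :
    MatrixSensing.gammaFun (MatrixSensing.alpha X Z) (MatrixSensing.beta X Z) ≤
      MatrixSensing.ripThreshold X Z := by
  refine le_csInf (Set.insert_nonempty _ _) ?_
  rintro δ (rfl | ⟨m, A, hX, hA⟩)
  · refine MatrixSensing.gammaFun_le_one ?_ ?_
    · exact div_le_one_of_le₀ (MatrixSensing.norm_perp_mul_transpose_le X Z) (norm_nonneg _)
    · exact MatrixSensing.beta_nonneg X Z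
  · exact MatrixSensing.gammaFun_le_of_isSecondOrderCritical hXZ hX hA
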